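/- For positive integers $k, n_1, \dots, n_k$, an integer $m \ge 0$, and matrices $\mathbf{A}^1 \in [0,1]^{n_1 \times m}, \dots, \mathbf{A}^k \in [0,1]^{n_k \times m}$, define the asymmetric $k$-color discrepancy $$\operatorname{odisc}(\mathbf{A}^1, \dots, \mathbf{A}^k) := \min_{\chi : [m] \to [k]} \ \max_{s \in [k]} \left\| \mathbf{A}^s \left( \tfrac{1}{k} \cdot \mathbf{1} - \mathbf{1}(\chi^{-1}(s)) \right) \right\|_\infty ,$$ where $[m] = \{1,\dots,m\}$, $\mathbf{1}$ is the all-ones vector in $\mathbb{R}^m$ and $\mathbf{1}(S) \in \{0,1\}^m$ is the indicator vector of $S \subseteq [m]$. Let $$\operatorname{odisc}^{\max}(n_1, \dots, n_k) := \sup_{m} \ \sup_{\mathbf{A}^1 \in [0,1]^{n_1 \times m}, \dots, \mathbf{A}^k \in [0,1]^{n_k \times m}} \operatorname{odisc}(\mathbf{A}^1, \dots, \mathbf{A}^k) \in [0, \infty].$$ **Theorem.** There is an absolute constant $C > 0$ such that for all positive integers $k$ and $n_1 \ge n_2 \ge \dots \ge n_k$, $$\operatorname{odisc}^{\max}(n_1,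 \dots, n_k) \le C \sqrt{n_1}.$$ -/

import Mathlib

open scoped Matrix

/-- The discrepancy vector of colour `s` under the colouring `χ : [m] → [k]`, measured by the
matrix `M`, that is `M ((1/k) · 𝟏 - 𝟏(χ⁻¹(s)))`. -/
noncomputable def colorDiscVec {k m n : ℕ} (M : Matrix (Fin n) (Fin m) ℝ)
    (χ : Fin m → Fin k) (s : Fin k) : Fin n → ℝ :=
  M *ᵥ ((1 / (k : ℝ)) • (1 : Fin m → ℝ) - (χ ⁻¹' {s}).indicator (1 : Fin m → ℝ))

/-- The asymmetric `k`-colour discrepancy of `k` matrices with the same number `m` of columns.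
The norm on `Fin (n s) → ℝ` is the supremum norm. The minimum over colourings and the maximum
over colours range over finite index sets, which are nonempty for `k ≥ 1`. -/
noncomputable def asymDisc {k m : ℕ} {n : Fin k → ℕ}
    (A : (s : Fin k) → Matrix (Fin (n s)) (Fin m) ℝ) : ℝ :=
  ⨅ χ : Fin m → Fin k, ⨆ s : Fin k, ‖colorDiscVec (A s) χ s‖

/-- The largest asymmetric `k`-colour discrepancy of matrices with entries in `[0, 1]` and
`n 0, n 1, …` rows, over all numbers of columns. The supremum is taken in the extended reals, so
that it is `⊤` if the discrepancies are unbounded. -/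
noncomputable def maxAsymDisc {k : ℕ} (n : Fin k → ℕ) : EReal :=
  ⨆ (m : ℕ) (A : (s : Fin k) → Matrix (Fin (n s)) (Fin m) ℝ)
    (_ : ∀ s i j, A s i j ∈ Set.Icc (0 : ℝ) 1), ((asymDisc A : ℝ) : EReal)

/-! The proof is divide and conquer on the set `K` of colours. Split `K` into two nearly equal
halves and stack the matrices of all colours in `K`, giving at most `|K| N` rows. Linear discrepancy
(`exists_subset_row_sums`) splits the columns between the halves in the right proportion, up to
`O(√(|K| N))` in every row. A colour's final share divides this error by the size of its half, so
this level costs `O(√(N / |K|))`. These costs grow geometrically as `K` shrinks, so their sum is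
`O(√N)` (`exists_balanced_coloring`).

Linear discrepancy `O(√n)` for `n` rows rests on Spencer's theorem, proved by partial colouring
(`exists_partial_coloring`). Row sums of random signs, rounded to multiples of a suitable width,
have a fibre too large for a Hamming ball of radius `m / 4`. Half the difference of two distant
members of the fibre is a partial colouring, and iteration colours every column. An extreme point
argument (`exists_few_fractional`) reduces to at most `n` fractional columns, which are then rounded
bit by bit. -/

/-- The real sign attached to a Boolean. -/
def boolSign (b : Bool) : ℝ := if b then 1 else -1

lemma boolSign_not (b : Bool) : boolSign (!b) = -boolSign b := by
  cases b <;> simp [boolSign]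

lemma boolSign_sq (b : Bool) : boolSign b ^ 2 = 1 := by
  cases b <;> simp [boolSign]

/-! ### Moments of random signed sums and Hamming balls -/

section Moments

variable {J : Type*} [Fintype J] [DecidableEq J]

lemma sum_flip (j : J) (f : (J → Bool) → ℝ) :
    ∑ σ, f (Function.update σ j (!σ j)) = ∑ σ, f σ := by
  have hinv : Function.Involutive (fun σ : J → Bool => Function.update σ j (!σ j)) := by
    intro σ
    simp
  exact Equiv.sum_comp hinv.toPerm f

lemma sum_boolSign_insert {J : Type*} [DecidableEq J] {a : J → ℝ} {s : Finset J} {j : J} (hj : j ∉ s) (σ : J → Bool) :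
    ∑ i ∈ insert j s, a i * boolSign (Function.update σ j (!σ j) i) =
      ∑ i ∈ s, a i * boolSign (σ i) - a j * boolSign (σ j) := by
  rw [Finset.sum_insert hj]
  have : ∑ i ∈ s, a i * boolSign (Function.update σ j (!σ j) i) =
      ∑ i ∈ s, a i * boolSign (σ i) := by
    refine Finset.sum_congr rfl fun i hi => ?_
    rw [Function.update_of_ne (by rintro rfl; exact hj hi)]
  rw [this, Function.update_self, boolSign_not]
  ring

/-- Averaging over the flip of the new sign removes the cross term: `(x + e)² + (x - e)² = 2x² +
2e²`. -/
lemma sum_sq_boolSign_le {a : J → ℝ} (ha : ∀ j, |a j| ≤ 1) (s : Finset J) :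
    ∑ σ : J → Bool, (∑ j ∈ s, a j * boolSign (σ j)) ^ 2 ≤
      (s.card : ℝ) * 2 ^ Fintype.card J := by
  induction s using Finset.induction_on with
  | empty => simp
  | insert j s hj ih =>
    have h1 := sum_flip j (fun σ : J → Bool => (∑ i ∈ insert j s, a i * boolSign (σ i)) ^ 2)
    have haj : a j ^ 2 ≤ 1 := (sq_le_one_iff_abs_le_one _).2 (ha j)
    have h2 : 2 * ∑ σ : J → Bool, (∑ i ∈ insert j s, a i * boolSign (σ i)) ^ 2 ≤
        ∑ σ : J → Bool, (2 * (∑ i ∈ s, a i * boolSign (σ i)) ^ 2 + 2) := by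
      rw [two_mul]
      nth_rewrite 2 [← h1]
      rw [← Finset.sum_add_distrib]
      refine Finset.sum_le_sum fun σ _ => ?_
      rw [sum_boolSign_insert hj, Finset.sum_insert hj]
      have := boolSign_sq (σ j)
      have h3 : (a j * boolSign (σ j)) ^ 2 ≤ 1 := by rw [mul_pow, this, mul_one]; exact haj
      linarith
    rw [Finset.sum_add_distrib, ← Finset.mul_sum] at h2
    simp only [Finset.sum_const, Finset.card_univ, Fintype.card_fun, Fintype.card_bool,
      nsmul_eq_mul] at h2
    rw [Finset.card_insert_of_notMem hj]
    push_cast at h2 ⊢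
    linarith

/-- The same flip gives `2x⁴ + 12x²e² + 2e⁴`; with the second moment, the induction closes because
`3s² + 6s + 1 ≤ 3(s + 1)²`. -/
lemma sum_pow_four_boolSign_le {a : J → ℝ} (ha : ∀ j, |a j| ≤ 1) (s : Finset J) :
    ∑ σ : J → Bool, (∑ j ∈ s, a j * boolSign (σ j)) ^ 4 ≤
      3 * (s.card : ℝ) ^ 2 * 2 ^ Fintype.card J := by
  induction s using Finset.induction_on with
  | empty => simp
  | insert j s hj ih =>
    have h1 := sum_flip j (fun σ : J → Bool => (∑ i ∈ insert j s, a i * boolSign (σ i)) ^ 4)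
    have haj : a j ^ 2 ≤ 1 := (sq_le_one_iff_abs_le_one _).2 (ha j)
    have h2 : 2 * ∑ σ : J → Bool, (∑ i ∈ insert j s, a i * boolSign (σ i)) ^ 4 ≤
        ∑ σ : J → Bool, (2 * (∑ i ∈ s, a i * boolSign (σ i)) ^ 4 +
          12 * (∑ i ∈ s, a i * boolSign (σ i)) ^ 2 + 2) := by
      rw [two_mul]
      nth_rewrite 2 [← h1]
      rw [← Finset.sum_add_distrib]
      refine Finset.sum_le_sum fun σ _ => ?_
      rw [sum_boolSign_insert hj, Finset.sum_insert hj]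
      have := boolSign_sq (σ j)
      have h3 : (a j * boolSign (σ j)) ^ 2 ≤ 1 := by rw [mul_pow, this, mul_one]; exact haj
      generalize a j * boolSign (σ j) = e at h3
      generalize ∑ i ∈ s, a i * boolSign (σ i) = x
      have h4 : e ^ 4 ≤ 1 := by
        calc e ^ 4 = (e ^ 2) ^ 2 := by ring
          _ ≤ 1 := pow_le_one₀ (sq_nonneg e) h3
      have h5 : x ^ 2 * e ^ 2 ≤ x ^ 2 := mul_le_of_le_one_right (sq_nonneg x) h3
      linarith
    rw [Finset.sum_add_distrib, Finset.sum_add_distrib, ← Finset.mul_sum, ← Finset.mul_sum] at h2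
    simp only [Finset.sum_const, Finset.card_univ, Fintype.card_fun, Fintype.card_bool,
      nsmul_eq_mul] at h2
    rw [Finset.card_insert_of_notMem hj]
    have h6 := sum_sq_boolSign_le ha s
    have h7 : (0 : ℝ) ≤ 2 ^ Fintype.card J := by positivity
    push_cast at h2 ⊢
    linarith

/-- The number of sign vectors in a Hamming ball of radius `m / 4`. -/
lemma card_hamming_ball_le (τ : J → Bool) :
    ((Finset.univ.filter fun σ : J → Bool => 4 * hammingDist σ τ ≤ Fintype.card J).card : ℝ) ≤
      (5 / 4 * √2) ^ Fintype.card J := by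
  have hs : (√2 : ℝ) ^ 2 = 2 := Real.sq_sqrt (by norm_num)
  -- Exponential Markov bound: the weight `(1/4) ^ dist` factors over coordinates, and in the ball
  -- it is at least `√2 ^ (-m)`.
  have h1 : ∑ σ : J → Bool, ((1 : ℝ) / 4) ^ hammingDist σ τ = (5 / 4) ^ Fintype.card J := by
    have h := Finset.prod_univ_sum (fun _ : J => (Finset.univ : Finset Bool))
      (fun j b => if b ≠ τ j then (1 : ℝ) / 4 else 1)
    rw [Fintype.piFinset_univ] at h
    have h2 : ∀ j, ∑ b : Bool, (if b ≠ τ j then (1 : ℝ) / 4 else 1) = 5 / 4 := by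
      intro j
      cases τ j <;> norm_num
    simp only [h2, Finset.prod_const, Finset.card_univ] at h
    rw [h]
    refine Finset.sum_congr rfl fun σ _ => ?_
    rw [← Finset.prod_filter, Finset.prod_const]
    rfl
  rw [mul_pow, ← h1, Finset.sum_mul, Finset.card_eq_sum_ones, Nat.cast_sum, Finset.sum_filter]
  refine Finset.sum_le_sum fun σ _ => ?_
  split_ifs with h
  · calc ((1 : ℕ) : ℝ) = (1 / 4) ^ hammingDist σ τ * (√2) ^ (4 * hammingDist σ τ) := by
          rw [pow_mul, ← mul_pow, show (√2 : ℝ) ^ 4 = (√2 ^ 2) ^ 2 by ring, hs]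
          norm_num
      _ ≤ _ := by
          gcongr
          exact Real.one_le_sqrt.2 (by norm_num)
  · positivity

end Moments

/-! ### Weighted pigeonhole for integer vectors -/

lemma sum_Icc_pow_natAbs_le {r : ℝ} (h0 : 0 ≤ r) (h1 : r ≤ 1 / 2) (R : ℕ) :
    ∑ b ∈ Finset.Icc (-(R : ℤ)) R, r ^ b.natAbs ≤ 1 + 4 * r - 4 * r ^ (R + 1) := by
  induction R with
  | zero => simp
  | succ R ih =>
    have : Finset.Icc (-((R + 1 : ℕ) : ℤ)) ((R + 1 : ℕ) : ℤ) =
        insert ((R : ℤ) + 1) (insert (-((R : ℤ) + 1)) (Finset.Icc (-(R : ℤ)) R)) := by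
      ext b
      simp only [Finset.mem_Icc, Finset.mem_insert]
      omega
    rw [this, Finset.sum_insert, Finset.sum_insert]
    · have e1 : ((R : ℤ) + 1).natAbs = R + 1 := by omega
      have e2 : (-((R : ℤ) + 1)).natAbs = R + 1 := by omega
      rw [e1, e2]
      have : r ^ (R + 2) ≤ r ^ (R + 1) * (1 / 2) := by
        rw [pow_succ r (R + 1)]
        gcongr
      linarith
    · simp only [Finset.mem_Icc]; omega
    · simp only [Finset.mem_Icc, Finset.mem_insert]; omega

/-- If the weights `r ^ ∑ |b i|` of integer vectors are large on average, some integer vector has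
a large fibre. -/
lemma exists_large_fiber {S ι : Type*} [Fintype S] [Nonempty S] [Fintype ι]
    (b : S → ι → ℤ) {r c : ℝ} (h0 : 0 < r) (h1 : r ≤ 1 / 2)
    (hc : -Real.log r * ∑ σ, ∑ i, ((b σ i).natAbs : ℝ) ≤ c * Fintype.card S) :
    ∃ v : ι → ℤ, (Fintype.card S : ℝ) * Real.exp (-(c + 4 * r * Fintype.card ι)) ≤
      ((Finset.univ.filter fun σ => b σ = v).card : ℝ) := by
  classical
  let w : (ι → ℤ) → ℝ := fun v => ∏ i, r ^ (v i).natAbs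
  have hw : ∀ v, w v = Real.exp (Real.log r * ∑ i, ((v i).natAbs : ℝ)) := by
    intro v
    rw [Finset.mul_sum, Real.exp_sum]
    refine Finset.prod_congr rfl fun i _ => ?_
    rw [mul_comm, Real.exp_nat_mul, Real.exp_log h0]
  -- Jensen's inequality, via the tangent line of `exp` at `-c`.
  have hlow : (Fintype.card S : ℝ) * Real.exp (-c) ≤ ∑ σ, w (b σ) := by
    have h2 : ∀ σ, Real.exp (-c) * (c + Real.log r * (∑ i, ((b σ i).natAbs : ℝ)) + 1) ≤
        w (b σ) := by
      intro σ
      rw [hw]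
      have := Real.add_one_le_exp (c + Real.log r * ∑ i, ((b σ i).natAbs : ℝ))
      calc _ ≤ Real.exp (-c) * Real.exp (c + Real.log r * ∑ i, ((b σ i).natAbs : ℝ)) := by gcongr
        _ = _ := by rw [← Real.exp_add]; ring_nf
    refine le_trans ?_ (Finset.sum_le_sum fun σ _ => h2 σ)
    rw [← Finset.mul_sum, Finset.sum_add_distrib, Finset.sum_add_distrib, ← Finset.mul_sum]
    simp only [Finset.sum_const, Finset.card_univ, nsmul_eq_mul]
    rw [mul_comm]
    gcongr
    linarith
  obtain ⟨R, hR⟩ : ∃ R : ℕ, ∀ σ i, (b σ i).natAbs ≤ R := by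
    refine ⟨∑ σ, ∑ i, (b σ i).natAbs, fun σ i => ?_⟩
    calc (b σ i).natAbs ≤ ∑ i, (b σ i).natAbs :=
          Finset.single_le_sum (f := fun i => (b σ i).natAbs) (fun _ _ => Nat.zero_le _)
            (Finset.mem_univ i)
      _ ≤ _ := Finset.single_le_sum (f := fun σ => ∑ i, (b σ i).natAbs)
            (fun _ _ => Nat.zero_le _) (Finset.mem_univ σ)
  -- The total weight of all candidate vectors is at most `(1 + 4r) ^ |ι|`; dividing by it bounds
  -- the largest fibre from below.
  have hbox : ∑ v ∈ Fintype.piFinset (fun _ : ι => Finset.Icc (-(R : ℤ)) R), w v ≤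
      Real.exp (4 * r * Fintype.card ι) := by
    have := Finset.prod_univ_sum (fun _ : ι => Finset.Icc (-(R : ℤ)) R)
      (fun _ z => r ^ z.natAbs)
    rw [← this, Finset.prod_const, Finset.card_univ, mul_comm, Real.exp_nat_mul]
    have h3 := sum_Icc_pow_natAbs_le h0.le h1 R
    have h4 := Real.add_one_le_exp (4 * r)
    have h5 : 0 < r ^ (R + 1) := by positivity
    refine pow_le_pow_left₀ (Finset.sum_nonneg fun _ _ => by positivity) ?_ _
    linarith
  have hwpos : ∀ v, 0 ≤ w v := fun v => Finset.prod_nonneg fun _ _ => by positivity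
  obtain ⟨σ₀⟩ := ‹Nonempty S›
  obtain ⟨v, -, hv⟩ := (Finset.univ.image b).exists_max_image
    (fun v => (Finset.univ.filter fun σ => b σ = v).card) ⟨b σ₀, by simp⟩
  refine ⟨v, ?_⟩
  set M := (Finset.univ.filter fun σ => b σ = v).card with hM
  have hup : ∑ σ, w (b σ) ≤ M * Real.exp (4 * r * Fintype.card ι) := by
    rw [Finset.sum_comp w b]
    calc _ ≤ ∑ u ∈ Finset.univ.image b, (M : ℝ) * w u := by
          refine Finset.sum_le_sum fun u hu => ?_
          rw [nsmul_eq_mul]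
          exact mul_le_mul_of_nonneg_right (by exact_mod_cast hv u hu) (hwpos u)
      _ = M * ∑ u ∈ Finset.univ.image b, w u := by rw [Finset.mul_sum]
      _ ≤ _ := by
          refine mul_le_mul_of_nonneg_left (le_trans ?_ hbox) (Nat.cast_nonneg _)
          refine Finset.sum_le_sum_of_subset_of_nonneg ?_ fun u _ _ => hwpos u
          intro u hu
          obtain ⟨σ, -, rfl⟩ := Finset.mem_image.1 hu
          rw [Fintype.mem_piFinset]
          intro i
          have := hR σ i
          rw [Finset.mem_Icc]
          omega
  have h6 := hlow.trans hup
  rw [neg_add, Real.exp_add, ← mul_assoc, Real.exp_neg (4 * r * _)]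
  rw [← div_eq_mul_inv, div_le_iff₀ (Real.exp_pos _)]
  exact h6

/-- A nonzero rounding forces `2|t| ≥ 1`, so any power of `2|t|` dominates; the fourth matches the
moment bound. -/
lemma natAbs_round_le_pow_four (t : ℝ) : ((round t).natAbs : ℝ) ≤ 16 * t ^ 4 := by
  rw [Nat.cast_natAbs, Int.cast_abs]
  have h1 := abs_le.1 (abs_sub_round t)
  by_cases h0 : round t = 0
  · rw [h0]; simp; positivity
  have h2 : (1 : ℝ) ≤ |(round t : ℝ)| := by
    rw [← Int.cast_abs]
    exact_mod_cast Int.one_le_abs h0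
  have h3 : |(round t : ℝ)| ≤ |t| + 1 / 2 := by
    have := abs_sub_abs_le_abs_sub (round t : ℝ) t
    have := abs_sub_round t
    rw [abs_sub_comm] at this
    linarith
  have h4 : 1 ≤ 2 * |t| := by linarith
  calc |(round t : ℝ)| ≤ 2 * |t| := by linarith
    _ ≤ (2 * |t|) ^ 4 := le_self_pow₀ h4 (by norm_num)
    _ = 16 * t ^ 4 := by rw [mul_pow, Even.pow_abs (by decide)]; norm_num

/-! ### Spencer's theorem by partial colouring -/

section Coloring

variable {ι J : Type*} [Fintype ι]

/-- A partial colouring with at least a quarter of the columns coloured. The parameters are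
`p = m ^ (1 / 8)` and `q = n ^ (1 / 8)`. -/
lemma exists_partial_coloring [Fintype J] (A : ι → J → ℝ) (hA : ∀ i j, |A i j| ≤ 1) {p q : ℝ} (hp : 0 < p)
    (hpq : p ≤ q) (hm : (Fintype.card J : ℝ) = p ^ 8) (hn : (Fintype.card ι : ℝ) ≤ q ^ 8) :
    ∃ e : J → ℝ, (∀ j, e j = 0 ∨ e j = 1 ∨ e j = -1) ∧
      Fintype.card J < 4 * (Finset.univ.filter fun j => e j ≠ 0).card ∧
      ∀ i, |∑ j, A i j * e j| ≤ 12 * p * q ^ 3 := by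
  classical
  have hq : 0 < q := hp.trans_le hpq
  -- Up to constants, the entropy cost is `n m² / D⁴` times a logarithm. Bounding that logarithm by
  -- `u = (n / m) ^ (1 / 2)` and asking for cost at most of order `m` gives `D` of order `m ^ (1 /
  -- 8) * n ^ (3 / 8)`.
  set D : ℝ := 12 * p * q ^ 3 with hD
  have hD0 : 0 < D := by positivity
  set u : ℝ := q ^ 4 / p ^ 4 with hu
  have hu1 : 1 ≤ u := by
    rw [hu, one_le_div (by positivity)]
    gcongr
  -- This makes `r n ≤ m / 81`, so both terms of the fibre exponent are below `m / 20`.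
  set r : ℝ := 1 / (9 * u) ^ 2 with hr
  have hr0 : 0 < r := by positivity
  have hr1 : r ≤ 1 / 2 := by
    rw [hr]
    apply one_div_le_one_div_of_le (by norm_num)
    nlinarith
  have hlog : -Real.log r ≤ 18 * u := by
    rw [hr, one_div, Real.log_inv, neg_neg, Real.log_pow]
    have := Real.log_le_sub_one_of_pos (show 0 < 9 * u by positivity)
    push_cast
    linarith
  set x : (J → Bool) → ι → ℝ := fun σ i => ∑ j, A i j * boolSign (σ j) with hx
  set b : (J → Bool) → ι → ℤ := fun σ i => round (x σ i / D) with hb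
  have hmom : ∑ σ, ∑ i, ((b σ i).natAbs : ℝ) ≤
      Fintype.card ι * (48 * (p ^ 8) ^ 2 / D ^ 4 * 2 ^ Fintype.card J) := by
    rw [Finset.sum_comm, ← nsmul_eq_mul, ← Finset.card_univ, ← Finset.sum_const]
    refine Finset.sum_le_sum fun i _ => ?_
    have h4 := sum_pow_four_boolSign_le (hA i) Finset.univ
    rw [Finset.card_univ, hm] at h4
    calc ∑ σ, ((b σ i).natAbs : ℝ) ≤ ∑ σ, 16 / D ^ 4 * (x σ i) ^ 4 := by
          refine Finset.sum_le_sum fun σ _ => (natAbs_round_le_pow_four _).trans ?_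
          rw [div_pow]
          exact le_of_eq (by ring)
      _ = 16 / D ^ 4 * ∑ σ, (x σ i) ^ 4 := by rw [Finset.mul_sum]
      _ ≤ 16 / D ^ 4 * (3 * (p ^ 8) ^ 2 * 2 ^ Fintype.card J) := by gcongr
      _ = _ := by ring
  have hcardS : (Fintype.card (J → Bool) : ℝ) = 2 ^ Fintype.card J := by simp
  have hc : -Real.log r * ∑ σ, ∑ i, ((b σ i).natAbs : ℝ) ≤
      p ^ 8 / 20 * Fintype.card (J → Bool) := by
    calc _ ≤ 18 * u * (q ^ 8 * (48 * (p ^ 8) ^ 2 / D ^ 4 * 2 ^ Fintype.card J)) := by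
          refine mul_le_mul hlog (hmom.trans ?_)
            (Finset.sum_nonneg fun _ _ => Finset.sum_nonneg fun _ _ => Nat.cast_nonneg _)
            (by positivity)
          gcongr
      _ = (864 / 20736) * (p ^ 8) * 2 ^ Fintype.card J := by
          rw [hu, hD]
          field_simp
          norm_num
      _ ≤ _ := by
          rw [hcardS]
          refine mul_le_mul_of_nonneg_right ?_ (by positivity)
          have : 0 < p ^ 8 := by positivity
          linarith
  obtain ⟨v, hv⟩ := exists_large_fiber b hr0 hr1 hc
  have hexp : p ^ 8 / 20 + 4 * r * Fintype.card ι ≤ Fintype.card J * (1 / 10) := by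
    have : r * Fintype.card ι ≤ p ^ 8 / 81 := by
      calc r * Fintype.card ι ≤ r * q ^ 8 := by gcongr
        _ = _ := by rw [hr, hu]; field_simp; norm_num
    have h8 : 0 < p ^ 8 := by positivity
    rw [hm]
    linarith
  have hpos : 0 < Fintype.card J := by
    have : (0 : ℝ) < Fintype.card J := by rw [hm]; positivity
    exact_mod_cast this
  have hbase : 5 / 4 * √2 < 2 * Real.exp (-(1 / 10)) := by
    have h1 : √2 < 1.415 := by
      rw [Real.sqrt_lt' (by norm_num)]; norm_num
    have h2 := Real.add_one_le_exp (-(1 / 10) : ℝ)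
    linarith
  have hbig : (5 / 4 * √2) ^ Fintype.card J <
      ((Finset.univ.filter fun σ => b σ = v).card : ℝ) := by
    refine lt_of_lt_of_le (pow_lt_pow_left₀ hbase (by positivity) hpos.ne') (le_trans ?_ hv)
    rw [mul_pow, hcardS, ← Real.exp_nat_mul]
    gcongr
    linarith
  have hne : (Finset.univ.filter fun σ => b σ = v).Nonempty := by
    rw [← Finset.card_pos]
    have : (0 : ℝ) < (Finset.univ.filter fun σ => b σ = v).card :=
      lt_of_le_of_lt (by positivity) hbig
    exact_mod_cast this
  obtain ⟨τ, hτ⟩ := hne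
  obtain ⟨σ, hσ, hστ⟩ : ∃ σ, b σ = v ∧ Fintype.card J < 4 * hammingDist σ τ := by
    by_contra! hcon
    refine absurd hbig (not_lt.2 (le_trans ?_ (card_hamming_ball_le τ)))
    have : (Finset.univ.filter fun σ => b σ = v) ⊆
        Finset.univ.filter fun σ : J → Bool => 4 * hammingDist σ τ ≤ Fintype.card J := by
      intro σ hσ
      simp only [Finset.mem_filter, Finset.mem_univ, true_and] at hσ ⊢
      exact hcon σ hσ
    exact_mod_cast Finset.card_le_card this
  simp only [Finset.mem_filter, Finset.mem_univ, true_and] at hτ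
  refine ⟨fun j => (boolSign (σ j) - boolSign (τ j)) / 2, fun j => ?_, ?_, fun i => ?_⟩
  · dsimp only
    generalize σ j = s, τ j = t
    cases s <;> cases t <;> norm_num [boolSign]
  · convert hστ using 2
    unfold hammingDist
    congr 1
    ext j
    simp only [Finset.mem_filter, Finset.mem_univ, true_and]
    generalize σ j = s, τ j = t
    cases s <;> cases t <;> norm_num [boolSign]
  · have h1 : ∑ j, A i j * ((boolSign (σ j) - boolSign (τ j)) / 2) = (x σ i - x τ i) / 2 := by
      simp only [hx]
      rw [← Finset.sum_sub_distrib, Finset.sum_div]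
      exact Finset.sum_congr rfl fun j _ => by ring
    have h2 : round (x σ i / D) = round (x τ i / D) := congr_fun (hσ.trans hτ.symm) i
    have h3 := abs_le.1 (abs_sub_round (x σ i / D))
    have h4 := abs_le.1 (abs_sub_round (x τ i / D))
    rw [h2] at h3
    have e1 : x σ i = D * (x σ i / D) := by field_simp
    have e2 : x τ i = D * (x τ i / D) := by field_simp
    rw [h1, abs_le, e1, e2]
    constructor <;> nlinarith

/-- A full colouring of discrepancy `O(m ^ (1 / 8) * n ^ (3 / 8))` for `m ≤ n` columns. -/
lemma exists_sign_coloring_finset (A : ι → J → ℝ) (hA : ∀ i j, |A i j| ≤ 1) {q : ℝ} (hq : 0 ≤ q)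
    (hn : (Fintype.card ι : ℝ) ≤ q ^ 8) (S : Finset J) {p : ℝ} (hp : 0 ≤ p) (hpq : p ≤ q)
    (hm : (S.card : ℝ) ≤ p ^ 8) :
    ∃ e : J → ℝ, (∀ j ∈ S, e j = 1 ∨ e j = -1) ∧ ∀ i, |∑ j ∈ S, A i j * e j| ≤ 400 * p * q ^ 3 := by
  classical
  induction S using Finset.strongInduction generalizing p with
  | H S ih =>
  obtain rfl | hS := S.eq_empty_or_nonempty
  · exact ⟨0, by simp, fun i => by simp; positivity⟩
  have hcpos : (0 : ℝ) < S.card := by exact_mod_cast hS.card_pos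
  obtain ⟨p₀, hp₀, hp₀m⟩ : ∃ p₀ : ℝ, 0 < p₀ ∧ (S.card : ℝ) = p₀ ^ 8 := by
    refine ⟨(S.card : ℝ) ^ (1 / 8 : ℝ), by positivity, ?_⟩
    rw [← Real.rpow_natCast, ← Real.rpow_mul hcpos.le]
    norm_num
  have hp₀p : p₀ ≤ p := by
    rw [hp₀m] at hm
    exact le_of_pow_le_pow_left₀ (by norm_num) hp hm
  obtain ⟨e, he, hcard, hdisc⟩ := exists_partial_coloring (J := S) (fun i j => A i j)
    (fun i j => hA i j) hp₀ (hp₀p.trans hpq) (by rw [Fintype.card_coe, hp₀m]) hn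
  rw [Fintype.card_coe] at hcard
  let f : J → ℝ := fun j => if h : j ∈ S then e ⟨j, h⟩ else 0
  have hf : ∀ j : S, f j = e j := fun j => by simp [f]
  have hfs : ∀ j, f j = 0 ∨ f j = 1 ∨ f j = -1 := by
    intro j
    by_cases h : j ∈ S
    · simpa [f, h] using he ⟨j, h⟩
    · simp [f, h]
  have hcard' : (Finset.univ.filter fun j => e j ≠ 0).card = (S.filter fun j => f j ≠ 0).card := by
    refine Finset.card_bij (fun j _ => (j : J)) ?_ ?_ ?_
    · intro j hj
      simp only [Finset.mem_filter, Finset.mem_univ, true_and] at hj ⊢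
      exact ⟨j.2, by rwa [hf]⟩
    · exact fun _ _ _ _ h => Subtype.ext h
    · intro j hj
      simp only [Finset.mem_filter] at hj
      exact ⟨⟨j, hj.1⟩, by simpa [← hf] using hj.2, rfl⟩
  set T := S.filter fun j => f j = 0 with hT
  have hsplit : (S.filter fun j => f j = 0).card + (S.filter fun j => f j ≠ 0).card = S.card :=
    Finset.card_filter_add_card_filter_not _
  rw [← hT] at hsplit
  have hTS : T ⊂ S := by
    refine Finset.ssubset_iff_subset_ne.2 ⟨Finset.filter_subset _ _, fun h => ?_⟩
    rw [h] at hsplit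
    omega
  have hTcard : (T.card : ℝ) ≤ 3 / 4 * S.card := by
    have : 4 * T.card ≤ 3 * S.card := by omega
    have : (4 * T.card : ℝ) ≤ 3 * S.card := by exact_mod_cast this
    linarith
  -- Here `0.97 ^ 8 ≥ 3 / 4` absorbs the loss of a quarter of the columns, and `400 = 12 / (1 -
  -- 0.97)` sums the geometric series.
  obtain ⟨g, hg, hgd⟩ := ih T hTS (p := 97 / 100 * p₀) (by positivity) (by linarith) (by
    rw [mul_pow, ← hp₀m]
    refine hTcard.trans ?_
    gcongr
    norm_num)
  refine ⟨fun j => if f j = 0 then g j else f j, fun j hj => ?_, fun i => ?_⟩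
  · dsimp only
    split_ifs with h
    · exact hg j (Finset.mem_filter.2 ⟨hj, h⟩)
    · exact (hfs j).resolve_left h
  · have h1 : ∑ j ∈ S, A i j * (if f j = 0 then g j else f j) =
        ∑ j ∈ S, A i j * f j + ∑ j ∈ T, A i j * g j := by
      rw [hT, Finset.sum_filter, ← Finset.sum_add_distrib]
      refine Finset.sum_congr rfl fun j _ => ?_
      split_ifs with h
      · rw [h]; ring
      · ring
    have h2 : ∑ j ∈ S, A i j * f j = ∑ j : S, A i j * e j := by
      rw [← Finset.sum_coe_sort S]
      exact Finset.sum_congr rfl fun j _ => by rw [hf]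
    rw [h1, h2]
    calc _ ≤ 12 * p₀ * q ^ 3 + 400 * (97 / 100 * p₀) * q ^ 3 :=
          (abs_add_le _ _).trans (add_le_add (hdisc i) (hgd i))
      _ = 400 * p₀ * q ^ 3 := by ring
      _ ≤ _ := by gcongr

/-- The hereditary form of Spencer's theorem: at most `n` columns of a matrix with at most `n` rows
have a signing of discrepancy `O(√n)`. -/
lemma exists_sign_coloring (A : ι → J → ℝ) (hA : ∀ i j, |A i j| ≤ 1) {n : ℝ}
    (hn : (Fintype.card ι : ℝ) ≤ n) (S : Finset J) (hS : (S.card : ℝ) ≤ n) :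
    ∃ e : J → ℝ, (∀ j ∈ S, e j = 1 ∨ e j = -1) ∧ ∀ i, |∑ j ∈ S, A i j * e j| ≤ 400 * √n := by
  have hn0 : 0 ≤ n := (Nat.cast_nonneg _).trans hn
  have h8 : (n ^ (1 / 8 : ℝ)) ^ 8 = n := by
    rw [← Real.rpow_natCast, ← Real.rpow_mul hn0]; norm_num
  have h4 : (n ^ (1 / 8 : ℝ)) ^ 4 = √n := by
    rw [eq_comm, Real.sqrt_eq_iff_mul_self_eq hn0 (by positivity), ← pow_add]
    exact h8.symm ▸ rfl
  obtain ⟨e, he, hd⟩ := exists_sign_coloring_finset A hA (q := n ^ (1 / 8 : ℝ)) (by positivity)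
    (by rwa [h8]) S (p := n ^ (1 / 8 : ℝ)) (by positivity) le_rfl (by rwa [h8])
  refine ⟨e, he, fun i => (hd i).trans (le_of_eq ?_)⟩
  rw [← h4]
  ring

end Coloring

/-! ### Linear discrepancy -/

section Rounding

variable {ι J : Type*} [Fintype ι]

/-- Signing the columns with odd numerator clears the last binary digit at cost `400√n / 2 ^ T`;
these costs add up to the stated factor. -/
lemma exists_rounding_dyadic (A : ι → J → ℝ) (hA : ∀ i j, |A i j| ≤ 1) {n : ℝ}
    (hn : (Fintype.card ι : ℝ) ≤ n) (S : Finset J) (hS : (S.card : ℝ) ≤ n) (T : ℕ)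
    (a : J → ℕ) (ha : ∀ j, a j ≤ 2 ^ T) :
    ∃ z : J → ℝ, (∀ j, z j = 0 ∨ z j = 1) ∧
      ∀ i, |∑ j ∈ S, A i j * (a j / 2 ^ T - z j)| ≤ 400 * √n * (1 - 1 / 2 ^ T) := by
  classical
  induction T generalizing a with
  | zero =>
    refine ⟨fun j => a j, fun j => ?_, fun i => by simp⟩
    have := ha j
    rcases (show a j = 0 ∨ a j = 1 by simp at this; omega) with h | h <;> simp [h]
  | succ T ih =>
    obtain ⟨e, he, hd⟩ := exists_sign_coloring A hA hn (S.filter fun j => Odd (a j))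
      (le_trans (by exact_mod_cast Finset.card_filter_le _ _) hS)
    let a' : J → ℕ := fun j => if e j = 1 then (a j + 1) / 2 else a j / 2
    obtain ⟨z, hz, hzd⟩ := ih a' fun j => by
      have := ha j
      rw [pow_succ] at this
      simp only [a']
      split_ifs <;> omega
    refine ⟨z, hz, fun i => ?_⟩
    have hsum : ∑ j ∈ S, A i j * (a j / 2 ^ (T + 1) - z j) =
        ∑ j ∈ S, A i j * (a' j / 2 ^ T - z j) -
          1 / 2 ^ (T + 1) * ∑ j ∈ S.filter (fun j => Odd (a j)), A i j * e j := by
      rw [Finset.sum_filter, Finset.mul_sum, ← Finset.sum_sub_distrib]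
      refine Finset.sum_congr rfl fun j hj => ?_
      have h2 : (2 : ℝ) ^ T ≠ 0 := by positivity
      split_ifs with hodd
      · obtain ⟨c, hc⟩ := id hodd
        rcases he j (Finset.mem_filter.2 ⟨hj, hodd⟩) with h | h
        · have : a' j = c + 1 := by simp only [a', h, if_true]; omega
          rw [this, hc, h]
          push_cast
          field_simp
          ring
        · have : a' j = c := by
            have h1 : ¬ (-1 : ℝ) = 1 := by norm_num
            simp only [a', h, h1, if_false]; omega
          rw [this, hc, h]
          push_cast
          field_simp
          ring
      · obtain ⟨c, hc⟩ := Nat.not_odd_iff_even.1 hodd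
        have : a' j = c := by simp only [a']; split_ifs <;> omega
        rw [this, hc]
        push_cast
        field_simp
        ring
    rw [hsum]
    calc _ ≤ 400 * √n * (1 - 1 / 2 ^ T) + 1 / 2 ^ (T + 1) * (400 * √n) := by
          refine (abs_sub _ _).trans (add_le_add (hzd i) ?_)
          rw [abs_mul, abs_of_pos (by positivity : (0 : ℝ) < 1 / 2 ^ (T + 1))]
          gcongr
          exact hd i
      _ = _ := by
          rw [pow_succ]
          field_simp
          ring

lemma exists_rounding_of_card_le (A : ι → J → ℝ) (hA : ∀ i j, |A i j| ≤ 1) {n : ℝ} (hn1 : 1 ≤ n)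
    (hn : (Fintype.card ι : ℝ) ≤ n) (S : Finset J) (hS : (S.card : ℝ) ≤ n)
    (x : J → ℝ) (hx : ∀ j, x j ∈ Set.Icc (0 : ℝ) 1) :
    ∃ z : J → ℝ, (∀ j, z j = 0 ∨ z j = 1) ∧
      ∀ i, |∑ j ∈ S, A i j * (x j - z j)| ≤ 401 * √n := by
  -- At this precision, truncation to dyadics costs at most `1 ≤ √n` per row in total.
  obtain ⟨T, hT⟩ : ∃ T : ℕ, S.card ≤ 2 ^ T := ⟨S.card, Nat.lt_two_pow_self.le⟩
  have h2 : (0 : ℝ) < 2 ^ T := by positivity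
  have hfl : ∀ j, |x j - (⌊x j * 2 ^ T⌋₊ : ℝ) / 2 ^ T| ≤ 1 / 2 ^ T := by
    intro j
    have h1 := Nat.floor_le (mul_nonneg (hx j).1 h2.le)
    have h3 := Nat.lt_floor_add_one (x j * 2 ^ T)
    rw [← div_le_iff₀ h2] at *
    rw [show x j - (⌊x j * 2 ^ T⌋₊ : ℝ) / 2 ^ T = (x j * 2 ^ T - ⌊x j * 2 ^ T⌋₊) / 2 ^ T by
      field_simp, abs_div, abs_of_pos h2, abs_of_nonneg (by rw [div_le_iff₀ h2] at h1; linarith)]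
    gcongr
    linarith
  obtain ⟨z, hz, hd⟩ := exists_rounding_dyadic A hA hn S hS T (fun j => ⌊x j * 2 ^ T⌋₊) fun j => by
    refine Nat.floor_le_of_le ?_
    push_cast
    exact mul_le_of_le_one_left h2.le (hx j).2
  refine ⟨z, hz, fun i => ?_⟩
  have hsum : ∑ j ∈ S, A i j * (x j - z j) =
      ∑ j ∈ S, A i j * (x j - (⌊x j * 2 ^ T⌋₊ : ℝ) / 2 ^ T) +
        ∑ j ∈ S, A i j * ((⌊x j * 2 ^ T⌋₊ : ℝ) / 2 ^ T - z j) := by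
    rw [← Finset.sum_add_distrib]
    exact Finset.sum_congr rfl fun j _ => by ring
  have h4 : |∑ j ∈ S, A i j * (x j - (⌊x j * 2 ^ T⌋₊ : ℝ) / 2 ^ T)| ≤ 1 := by
    calc _ ≤ ∑ j ∈ S, (1 : ℝ) / 2 ^ T := by
          refine (Finset.abs_sum_le_sum_abs _ _).trans (Finset.sum_le_sum fun j _ => ?_)
          rw [abs_mul, ← one_mul ((1 : ℝ) / 2 ^ T)]
          exact mul_le_mul (hA i j) (hfl j) (abs_nonneg _) zero_le_one
      _ = S.card / 2 ^ T := by rw [Finset.sum_const, nsmul_eq_mul, mul_one_div]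
      _ ≤ 1 := by rw [div_le_one h2]; exact_mod_cast hT
  have h5 : 1 ≤ √n := Real.one_le_sqrt.2 hn1
  have h6 : 400 * √n * (1 - 1 / 2 ^ T) ≤ 400 * √n :=
    mul_le_of_le_one_right (by positivity) (by linarith [one_div_pos.2 h2])
  rw [hsum]
  linarith [abs_add_le (∑ j ∈ S, A i j * (x j - (⌊x j * 2 ^ T⌋₊ : ℝ) / 2 ^ T))
    (∑ j ∈ S, A i j * ((⌊x j * 2 ^ T⌋₊ : ℝ) / 2 ^ T - z j)), hd i]

/-- A point of the unit cube can be moved, without changing its image under a matrix, to a point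
with at most as many fractional coordinates as the matrix has rows. -/
lemma exists_few_fractional [Fintype J] (A : ι → J → ℝ) (x : J → ℝ)
    (hx : ∀ j, x j ∈ Set.Icc (0 : ℝ) 1) :
    ∃ y : J → ℝ, (∀ j, y j ∈ Set.Icc (0 : ℝ) 1) ∧ (∀ i, ∑ j, A i j * y j = ∑ j, A i j * x j) ∧
      ∃ S : Finset J, S.card ≤ Fintype.card ι ∧ ∀ j ∉ S, y j = 0 ∨ y j = 1 := by
  classical
  set P : Set (J → ℝ) := Set.pi Set.univ (fun _ => Set.Icc (0 : ℝ) 1) ∩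
    {y | ∀ i, ∑ j, A i j * y j = ∑ j, A i j * x j} with hP
  have hPc : IsCompact P := by
    refine (isCompact_univ_pi fun _ => isCompact_Icc).inter_right ?_
    simp only [Set.ofPred_forall]
    exact isClosed_iInter fun i => isClosed_eq (by fun_prop) continuous_const
  obtain ⟨y, hy⟩ := hPc.extremePoints_nonempty ⟨x, fun j _ => hx j, fun i => rfl⟩
  rw [mem_extremePoints] at hy
  obtain ⟨⟨hy1, hy2⟩, hext⟩ := hy
  refine ⟨y, fun j => hy1 j trivial, hy2, Finset.univ.filter fun j => ¬ (y j = 0 ∨ y j = 1), ?_,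
    fun j hj => by simpa only [Finset.mem_filter, Finset.mem_univ, true_and, not_not] using hj⟩
  set S := Finset.univ.filter fun j => ¬ (y j = 0 ∨ y j = 1) with hS
  by_contra! hcard
  -- More fractional coordinates than rows yield a kernel direction, along which `y` can move both
  -- ways inside `P`, against extremality.
  let f : (S → ℝ) →ₗ[ℝ] (ι → ℝ) := Matrix.mulVecLin (Matrix.of fun i (j : S) => A i j)
  have hker : LinearMap.ker f ≠ ⊥ := by
    refine LinearMap.ker_ne_bot_of_finrank_lt ?_
    simpa using hcard
  obtain ⟨v, hv, hv0⟩ := (Submodule.ne_bot_iff _).1 hker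
  rw [LinearMap.mem_ker] at hv
  let w : J → ℝ := fun j => if h : j ∈ S then v ⟨j, h⟩ else 0
  have hw : ∀ i, ∑ j, A i j * w j = 0 := by
    intro i
    have h1 := congr_fun hv i
    simp only [f, Matrix.mulVecLin_apply, Matrix.mulVec, dotProduct, Matrix.of_apply,
      Pi.zero_apply] at h1
    rw [← h1, ← Finset.sum_subset (Finset.subset_univ S), ← Finset.sum_coe_sort S]
    · exact Finset.sum_congr rfl fun j _ => by simp [w]
    · intro j _ hj
      simp [w, hj]
  have hw0 : w ≠ 0 := by
    intro h
    refine hv0 (funext fun j => ?_)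
    have := congr_fun h j
    simpa [w] using this
  have hev : ∀ᶠ t in nhdsWithin (0 : ℝ) (Set.Ioi 0), ∀ j ∈ S,
      y j + t * w j ∈ Set.Ioo (0 : ℝ) 1 ∧ y j - t * w j ∈ Set.Ioo (0 : ℝ) 1 := by
    refine Filter.Eventually.filter_mono nhdsWithin_le_nhds ?_
    rw [Filter.eventually_all_finset]
    intro j hj
    have hyj : y j ∈ Set.Ioo (0 : ℝ) 1 := by
      rw [hS, Finset.mem_filter] at hj
      have h1 := hy1 j trivial
      push Not at hj
      exact ⟨lt_of_le_of_ne h1.1 (Ne.symm hj.2.1), lt_of_le_of_ne h1.2 hj.2.2⟩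
    refine Filter.Eventually.and ?_ ?_
    · exact (show ContinuousAt (fun t : ℝ => y j + t * w j) 0 by fun_prop).eventually_mem
        (by simpa using isOpen_Ioo.mem_nhds hyj)
    · exact (show ContinuousAt (fun t : ℝ => y j - t * w j) 0 by fun_prop).eventually_mem
        (by simpa using isOpen_Ioo.mem_nhds hyj)
  obtain ⟨t, ht, ht0⟩ := (hev.and self_mem_nhdsWithin).exists
  have hmem : ∀ c : ℝ, (∀ j ∈ S, y j + c * w j ∈ Set.Ioo (0 : ℝ) 1) → y + c • w ∈ P := by
    intro c hc
    refine ⟨fun j _ => ?_, fun i => ?_⟩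
    · by_cases hj : j ∈ S
      · exact Set.Ioo_subset_Icc_self (hc j hj)
      · simpa [w, hj] using hy1 j trivial
    · simp only [Pi.add_apply, Pi.smul_apply, smul_eq_mul, mul_add, Finset.sum_add_distrib]
      rw [hy2 i, show ∑ j, A i j * (c * w j) = c * ∑ j, A i j * w j by
        rw [Finset.mul_sum]; exact Finset.sum_congr rfl fun j _ => by ring, hw i]
      simp
  have h1 := hmem t fun j hj => (ht j hj).1
  have h2 := hmem (-t) fun j hj => by simpa [sub_eq_add_neg] using (ht j hj).2
  have h3 := (hext _ h1 _ h2 ⟨1 / 2, 1 / 2, by norm_num, by norm_num, by norm_num, by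
    ext j; simp; ring⟩).1
  have h4 : t • w = 0 := by simpa using h3
  exact hw0 ((smul_eq_zero.1 h4).resolve_left (ne_of_gt ht0))

/-- Spencer's theorem in the form of linear discrepancy. -/
lemma exists_rounding [Fintype J] (A : ι → J → ℝ) (hA : ∀ i j, |A i j| ≤ 1) {n : ℝ} (hn1 : 1 ≤ n)
    (hn : (Fintype.card ι : ℝ) ≤ n) (x : J → ℝ) (hx : ∀ j, x j ∈ Set.Icc (0 : ℝ) 1) :
    ∃ z : J → ℝ, (∀ j, z j = 0 ∨ z j = 1) ∧ ∀ i, |∑ j, A i j * (x j - z j)| ≤ 401 * √n := by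
  classical
  obtain ⟨y, hy, hAy, S, hS, hyS⟩ := exists_few_fractional A x hx
  obtain ⟨z, hz, hd⟩ := exists_rounding_of_card_le A hA hn1 hn S
    (le_trans (by exact_mod_cast hS) hn) y hy
  refine ⟨fun j => if j ∈ S then z j else y j, fun j => ?_, fun i => ?_⟩
  · dsimp only
    split_ifs with h
    exacts [hz j, hyS j h]
  · convert hd i using 2
    simp only [mul_sub, Finset.sum_sub_distrib]
    rw [← hAy i, ← Finset.sum_sub_distrib, ← Finset.sum_sub_distrib]
    rw [← Finset.sum_subset (Finset.subset_univ S)]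
    · exact Finset.sum_congr rfl fun j hj => by rw [if_pos hj]
    · intro j _ hj
      rw [if_neg hj, sub_self]

/-- A finite set of columns has a subset whose row sums are a `p`-fraction of those of the whole
set, up to an error `O(√n)`. -/
lemma exists_subset_row_sums (A : ι → J → ℝ) (hA : ∀ i j, |A i j| ≤ 1) {n : ℝ} (hn1 : 1 ≤ n)
    (hn : (Fintype.card ι : ℝ) ≤ n) (S : Finset J) {p : ℝ} (hp : p ∈ Set.Icc (0 : ℝ) 1) :
    ∃ S' ⊆ S, ∀ i, |p * ∑ j ∈ S, A i j - ∑ j ∈ S', A i j| ≤ 401 * √n := by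
  classical
  obtain ⟨z, hz, hd⟩ := exists_rounding (J := S) (fun i j => A i j) (fun i j => hA i j) hn1 hn
    (fun _ => p) fun _ => hp
  let z' : J → ℝ := fun j => if h : j ∈ S then z ⟨j, h⟩ else 0
  refine ⟨S.filter fun j => z' j = 1, Finset.filter_subset _ _, fun i => ?_⟩
  convert hd i using 2
  rw [Finset.sum_filter, Finset.mul_sum, ← Finset.sum_sub_distrib, ← Finset.sum_coe_sort S]
  refine Finset.sum_congr rfl fun j _ => ?_
  have : z' j = z j := by simp [z']
  rw [this]
  rcases hz j with h | h <;> simp [h] <;> ring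

end Rounding

/-! ### Recursive splitting of the colours -/

section ColorSplitting

variable {J κ : Type*} [DecidableEq κ]

/-- The split costs at most `3 * 401` in units of `√(N / k)`, while `1 / √k'` exceeds `1 / √k` by at
least `0.2 / √k`; hence `6015 = 15 * 401`. -/
lemma split_error_le {k k' N : ℝ} (hk : 0 < k) (h1 : k / 3 ≤ k')
    (h2 : k' ≤ 2 * k / 3) :
    401 * √(k * N) / k' + 6015 * √N * (1 - 1 / √k') ≤ 6015 * √N * (1 - 1 / √k) := by
  have hk' : 0 < k' := by linarith
  have hs : 0 < √k := Real.sqrt_pos.2 hk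
  have hs' : 0 < √k' := Real.sqrt_pos.2 hk'
  have h3 : √k / k' ≤ 3 * (1 / √k) := by
    rw [mul_one_div, div_le_div_iff₀ hk' hs, Real.mul_self_sqrt hk.le]
    linarith
  have h4 : 1.2 * (1 / √k) ≤ 1 / √k' := by
    rw [mul_one_div, div_le_div_iff₀ hs hs', one_mul]
    refine Real.le_sqrt_of_sq_le ?_
    rw [mul_pow, Real.sq_sqrt hk'.le]
    norm_num
    linarith
  have h5 : 401 * (√k / k') ≤ 6015 * (1 / √k' - 1 / √k) := by linarith
  rw [Real.sqrt_mul hk.le]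
  have h6 := mul_le_mul_of_nonneg_right h5 (Real.sqrt_nonneg N)
  have h7 : 401 * (√k * √N) / k' = 401 * (√k / k') * √N := by ring
  rw [h7]
  linarith

/-- Colour `s` occurs only inside `S'`, so its error is the splitting error scaled by `1 / k'` plus
the recursive error on `S'`. -/
lemma abs_color_sum_le {S S' : Finset J} (hS : S' ⊆ S) {a : J → ℝ} {χ χ' : J → κ} {s : κ}
    {k k' E D : ℝ} (hk : 0 < k) (hk' : 0 < k') (hχ : ∀ j ∈ S', χ j = χ' j)
    (hχs : ∀ j ∈ S, j ∉ S' → χ j ≠ s)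
    (hE : |k' / k * ∑ j ∈ S, a j - ∑ j ∈ S', a j| ≤ E)
    (hD : |∑ j ∈ S', a j * (1 / k' - if χ' j = s then 1 else 0)| ≤ D) :
    |∑ j ∈ S, a j * (1 / k - if χ j = s then 1 else 0)| ≤ E / k' + D := by
  have h1 : ∑ j ∈ S, a j * (if χ j = s then (1 : ℝ) else 0) =
      ∑ j ∈ S', a j * (if χ' j = s then (1 : ℝ) else 0) := by
    rw [← Finset.sum_subset hS]
    · exact Finset.sum_congr rfl fun j hj => by rw [hχ j hj]
    · intro j hj hj'
      rw [if_neg (hχs j hj hj'), mul_zero]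
  have h2 : ∑ j ∈ S, a j * (1 / k - if χ j = s then 1 else 0) =
      (k' / k * ∑ j ∈ S, a j - ∑ j ∈ S', a j) / k' +
        ∑ j ∈ S', a j * (1 / k' - if χ' j = s then 1 else 0) := by
    simp only [mul_sub, Finset.sum_sub_distrib, ← Finset.sum_mul]
    rw [h1]
    field_simp
    ring
  rw [h2]
  refine (abs_add_le _ _).trans (add_le_add ?_ hD)
  rw [abs_div, abs_of_pos hk']
  gcongr

/-- Each colour of a finite set `K` has its own matrix with at most `N` rows. The columns can be
coloured so that every colour class is balanced with respect to its own matrix. -/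
lemma exists_balanced_coloring {n : κ → ℕ} (A : (s : κ) → Fin (n s) → J → ℝ)
    (hA : ∀ s i j, |A s i j| ≤ 1) {N : ℝ} (hN : 1 ≤ N) (hn : ∀ s, (n s : ℝ) ≤ N)
    (K : Finset κ) (hK : K.Nonempty) (S : Finset J) :
    ∃ χ : J → κ, (∀ j, χ j ∈ K) ∧ ∀ s ∈ K, ∀ i,
      |∑ j ∈ S, A s i j * (1 / (K.card : ℝ) - if χ j = s then 1 else 0)| ≤
        6015 * √N * (1 - 1 / √(K.card : ℝ)) := by
  classical
  induction K using Finset.strongInduction generalizing S with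
  | H K ih =>
  obtain h1 | h2 : K.card = 1 ∨ 2 ≤ K.card := by
    have := hK.card_pos
    omega
  · obtain ⟨s, rfl⟩ := Finset.card_eq_one.1 h1
    refine ⟨fun _ => s, fun _ => by simp, fun t ht i => ?_⟩
    rw [Finset.mem_singleton] at ht
    subst ht
    simp
  · obtain ⟨K₁, hK₁, hc₁⟩ := Finset.exists_subset_card_eq (Nat.div_le_self K.card 2)
    set K₂ := K \ K₁ with hK₂
    have hc : K₁.card + K₂.card = K.card := by
      rw [hK₂, add_comm, Finset.card_sdiff_add_card_eq_card hK₁]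
    have hs₁ : K₁ ⊂ K := Finset.ssubset_iff_subset_ne.2 ⟨hK₁, fun h => by rw [h] at hc₁; omega⟩
    have hs₂ : K₂ ⊂ K := Finset.ssubset_iff_subset_ne.2
      ⟨Finset.sdiff_subset, fun h => by rw [h] at hc; omega⟩
    have hne₁ : K₁.Nonempty := Finset.card_pos.1 (by omega)
    have hne₂ : K₂.Nonempty := Finset.card_pos.1 (by omega)
    have hkpos : (0 : ℝ) < K.card := by exact_mod_cast hK.card_pos
    have hk₁pos : (0 : ℝ) < K₁.card := by exact_mod_cast hne₁.card_pos
    have hk₂pos : (0 : ℝ) < K₂.card := by exact_mod_cast hne₂.card_pos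
    have hcR : (K₁.card : ℝ) + K₂.card = K.card := by exact_mod_cast hc
    have hkge : (2 : ℝ) ≤ K.card := by exact_mod_cast h2
    have hrows : (Fintype.card ((s : K) × Fin (n s)) : ℝ) ≤ K.card * N := by
      rw [Fintype.card_sigma]
      push_cast
      simp only [Fintype.card_fin]
      calc ∑ s : K, (n s : ℝ) ≤ ∑ _s : K, N := Finset.sum_le_sum fun s _ => hn s
        _ = _ := by simp
    obtain ⟨S₁, hS₁, hd⟩ := exists_subset_row_sums
      (fun (r : (s : K) × Fin (n s)) j => A r.1 r.2 j) (fun r j => hA _ _ _)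
      (n := K.card * N) (by nlinarith) hrows S (p := (K₁.card : ℝ) / K.card)
      ⟨by positivity, by rw [div_le_one hkpos]; linarith⟩
    obtain ⟨χ₁, hχ₁, hd₁⟩ := ih K₁ hs₁ hne₁ S₁
    obtain ⟨χ₂, hχ₂, hd₂⟩ := ih K₂ hs₂ hne₂ (S \ S₁)
    refine ⟨fun j => if j ∈ S₁ then χ₁ j else χ₂ j, fun j => ?_, fun s hs i => ?_⟩
    · dsimp only
      split_ifs
      exacts [hs₁.1 (hχ₁ j), hs₂.1 (hχ₂ j)]
    have hdi : |(K₁.card : ℝ) / K.card * ∑ j ∈ S, A s i j - ∑ j ∈ S₁, A s i j| ≤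
        401 * √(K.card * N) := hd ⟨⟨s, hs⟩, i⟩
    by_cases hsK : s ∈ K₁
    · refine (abs_color_sum_le hS₁ hkpos hk₁pos (fun j hj => if_pos hj) (fun j _ hj => ?_)
        hdi (hd₁ s hsK i)).trans (split_error_le hkpos ?_ ?_)
      · rw [if_neg hj]
        rintro rfl
        exact (Finset.mem_sdiff.1 (hχ₂ j)).2 hsK
      · have : K.card ≤ 3 * K₁.card := by omega
        have : (K.card : ℝ) ≤ 3 * K₁.card := by exact_mod_cast this
        linarith
      · have : 3 * K₁.card ≤ 2 * K.card := by omega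
        have : (3 * K₁.card : ℝ) ≤ 2 * K.card := by exact_mod_cast this
        linarith
    · have hs2 : s ∈ K₂ := Finset.mem_sdiff.2 ⟨hs, hsK⟩
      -- The two proportions add to 1, so the complement has the opposite error.
      have hdi₂ : |(K₂.card : ℝ) / K.card * ∑ j ∈ S, A s i j - ∑ j ∈ S \ S₁, A s i j| ≤
          401 * √(K.card * N) := by
        rw [← abs_neg]
        convert hdi using 2
        have h3 := Finset.sum_sdiff (f := fun j => A s i j) hS₁
        rw [← h3, ← hcR]
        field_simp
        ring
      refine (abs_color_sum_le Finset.sdiff_subset hkpos hk₂pos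
        (fun j hj => if_neg (Finset.mem_sdiff.1 hj).2) (fun j hj hj' => ?_)
        hdi₂ (hd₂ s hs2 i)).trans (split_error_le hkpos ?_ ?_)
      · have hj1 : j ∈ S₁ := by
          by_contra h
          exact hj' (Finset.mem_sdiff.2 ⟨hj, h⟩)
        rw [if_pos hj1]
        rintro rfl
        exact hsK (hχ₁ j)
      · have : K.card ≤ 3 * K₂.card := by omega
        have : (K.card : ℝ) ≤ 3 * K₂.card := by exact_mod_cast this
        linarith
      · have : 3 * K₂.card ≤ 2 * K.card := by omega
        have : (3 * K₂.card : ℝ) ≤ 2 * K.card := by exact_mod_cast this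
        linarith

end ColorSplitting

/-! ### The discrepancy bound -/

lemma asymDisc_le {k m : ℕ} (hk : 0 < k) {n : Fin k → ℕ}
    (A : (s : Fin k) → Matrix (Fin (n s)) (Fin m) ℝ) (hA : ∀ s i j, |A s i j| ≤ 1) {N : ℝ}
    (hN : 1 ≤ N) (hn : ∀ s, (n s : ℝ) ≤ N) : asymDisc A ≤ 6015 * √N := by
  have : Nonempty (Fin k) := ⟨⟨0, hk⟩⟩
  obtain ⟨χ, -, hχ⟩ := exists_balanced_coloring A hA hN hn Finset.univ Finset.univ_nonempty
    Finset.univ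
  have hbdd : BddBelow (Set.range fun χ : Fin m → Fin k =>
      ⨆ s : Fin k, ‖colorDiscVec (A s) χ s‖) :=
    ⟨0, by rintro _ ⟨χ, rfl⟩; exact Real.iSup_nonneg fun s => norm_nonneg _⟩
  refine (ciInf_le hbdd χ).trans (ciSup_le fun s => ?_)
  rw [pi_norm_le_iff_of_nonneg (by positivity)]
  intro i
  have h1 := hχ s (Finset.mem_univ s) i
  rw [Finset.card_univ, Fintype.card_fin] at h1
  have h2 : colorDiscVec (A s) χ s i =
      ∑ j, A s i j * (1 / (k : ℝ) - if χ j = s then 1 else 0) := by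
    simp only [colorDiscVec, Matrix.mulVec, dotProduct]
    refine Finset.sum_congr rfl fun j _ => ?_
    by_cases h : χ j = s <;> simp [h, Set.indicator]
  rw [h2, Real.norm_eq_abs]
  refine h1.trans (mul_le_of_le_one_right (by positivity) ?_)
  have : 0 ≤ 1 / √(k : ℝ) := by positivity
  linarith

theorem mainTheorem4 :
    ∃ C : ℝ, 0 < C ∧
      ∀ (k : ℕ) (hk : 0 < k) (n : Fin k → ℕ), (∀ s, 0 < n s) → Antitone n →
        maxAsymDisc n ≤ ((C * Real.sqrt (n ⟨0, hk⟩ : ℝ) : ℝ) : EReal) := by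
  refine ⟨6015, by norm_num, fun k hk n hpos hanti => ?_⟩
  refine iSup_le fun m => iSup_le fun A => iSup_le fun hA => ?_
  rw [EReal.coe_le_coe_iff]
  refine asymDisc_le hk A (fun s i j => ?_) (by exact_mod_cast hpos _) fun s => ?_
  · exact abs_le.2 ⟨by linarith [(hA s i j).1], (hA s i j).2⟩
  · exact_mod_cast hanti (show (⟨0, hk⟩ : Fin k) ≤ s from Nat.zero_le _)
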